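/- For a finite simple graph $G$ with vertex set $V(G)$, let $\mathcal S(G)$ be the set of real symmetric matrices $A=(a_{ij})$ with rows and columns indexed by $V(G)$ such that, for all $i\neq j$, $a_{ij}=0$ if and only if $ij$ is not an edge of $G$ (the diagonal entries are arbitrary). For a real symmetric matrix $A$, let $q(A)$ be the number of distinct eigenvalues of $A$, and let $q(G)=\min\{q(A) : A\in\mathcal S(G)\}$. The join $G\vee H$ of two graphs on disjoint vertex sets is the graph with vertex set $V(G)\cup V(H)$ whose edges are those of $G$, those of $H$, and all pairs $uv$ with $u\in V(G)$ and $v\in V(H)$. **Lemma.** Let $n\ge 1$, let $H$ be any simple graph on $n$ vertices, and let $n'\ge n$. Then $q(K_{n'}\vee H)=2$. -/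

import Mathlib

namespace QParam

/-- `𝒮(G)`: the real symmetric matrices indexed by the vertices of `G` whose off-diagonal entry at
`(i, j)` is zero if and only if `i` and `j` are not adjacent. The diagonal is unrestricted. -/
def matricesOf {V : Type*} (G : SimpleGraph V) : Set (Matrix V V ℝ) :=
  {A | A.IsSymm ∧ ∀ i j, i ≠ j → (A i j = 0 ↔ ¬ G.Adj i j)}

/-- `q(A)`: the number of distinct (real) eigenvalues of `A`. -/
noncomputable def numEigenvalues {V : Type*} [Fintype V] (A : Matrix V V ℝ) : ℕ :=
  Set.ncard {μ : ℝ | Module.End.HasEigenvalue A.mulVecLin μ}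

/-- `q(G) = min {q(A) : A ∈ 𝒮(G)}`. -/
noncomputable def q {V : Type*} [Fintype V] (G : SimpleGraph V) : ℕ :=
  sInf (numEigenvalues '' matricesOf G)

/-- `𝒮(G)` is never empty: it contains the adjacency matrix. -/
theorem matricesOf_nonempty {V : Type*} (G : SimpleGraph V) : (matricesOf G).Nonempty := by
  classical
  refine ⟨G.adjMatrix ℝ, G.isSymm_adjMatrix, fun i j _ => ?_⟩
  simp [SimpleGraph.adjMatrix_apply]

/-- The infimum defining `q(G)` is an attained minimum. -/
theorem q_isLeast {V : Type*} [Fintype V] (G : SimpleGraph V) :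
    IsLeast (numEigenvalues '' matricesOf G) (q G) :=
  ⟨Nat.sInf_mem ((matricesOf_nonempty G).image _), fun _ h => Nat.sInf_le h⟩

/-- The join `G ∨ H`: the disjoint union of `G` and `H` together with all edges between them. -/
def join {V W : Type*} (G : SimpleGraph V) (H : SimpleGraph W) : SimpleGraph (V ⊕ W) :=
  SimpleGraph.sum G H ⊔ completeBipartiteGraph V W

end QParam

open Matrix

namespace QParam

/-! A scalar matrix cannot fit a graph with an edge, so `q ≥ 2`. For the upper bound, build a
symmetric involution with blocks `N`, `R`, `Rᵀ`, `S`; its eigenvalues lie in `{1, -1}`. Scale a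
matrix of `𝒮(H)` to a strict contraction `S` and factor `1 - S * S = Rᵀ * R`, possible since `V` is
at least as large as `W`. Choosing `N = R(1+S)⁻¹Rᵀ - 1` makes the Schur complement of `1 + S` in
(matrix + 1) vanish, and the whole squares to `1`. It remains to remove zeros from `R` and from off
the diagonal of `N`. Replacing `R` by `Q * R`, `Q` a symmetric orthogonal matrix, keeps `Rᵀ * R` and
conjugates `N`. For a Householder `Q` along `u`, each bad zero is a polynomial equation in `u`,
nontrivial because `R` has no zero column and `N` is not scalar; a generic `u` avoids them all. -/

/-- A symmetric real matrix with a single eigenvalue is a scalar matrix. -/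
theorem eq_smul_one_of_numEigenvalues_le_one {ι : Type*} [Fintype ι] [DecidableEq ι] [Nonempty ι]
    {A : Matrix ι ι ℝ} (hA : A.IsSymm) (h : numEigenvalues A ≤ 1) : ∃ c : ℝ, A = c • 1 := by
  have hH : A.IsHermitian := by rw [IsHermitian, conjTranspose_eq_transpose_of_trivial]; exact hA
  have hev : ∀ i, Module.End.HasEigenvalue A.mulVecLin (hH.eigenvalues i) := by
    intro i
    rw [← Matrix.toLin'_apply', Module.End.hasEigenvalue_iff_mem_spectrum, Matrix.spectrum_toLin']
    exact hH.eigenvalues_mem_spectrum_real i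
  have hone := (Set.ncard_le_one (Module.End.finite_hasEigenvalue A.mulVecLin)).1 h
  obtain ⟨i₀⟩ := ‹Nonempty ι›
  refine ⟨hH.eigenvalues i₀, ?_⟩
  have hc : (RCLike.ofReal ∘ hH.eigenvalues : ι → ℝ) = fun _ => hH.eigenvalues i₀ := by
    funext i
    exact hone _ (hev i) _ (hev i₀)
  conv_lhs => rw [hH.spectral_theorem, hc, ← smul_one_eq_diagonal, map_smul, map_one]

/-- A graph with an edge has `q ≥ 2`. -/
theorem two_le_q_of_adj {ι : Type*} [Fintype ι] {G : SimpleGraph ι} {i j : ι} (hij : G.Adj i j) :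
    2 ≤ q G := by
  classical
  obtain ⟨A, ⟨hA, hpat⟩, hq⟩ := (q_isLeast G).1
  by_contra hlt
  have : Nonempty ι := ⟨i⟩
  obtain ⟨c, hc⟩ := eq_smul_one_of_numEigenvalues_le_one hA (by omega)
  exact (hpat i j hij.ne).1 (by simp [hc, hij.ne]) hij

/-- A matrix of `𝒮(G)` whose square is the identity witnesses `q(G) ≤ 2`. -/
theorem q_le_two_of_mul_self {ι : Type*} [Fintype ι] [DecidableEq ι] {G : SimpleGraph ι}
    {A : Matrix ι ι ℝ} (hA : A ∈ matricesOf G) (hsq : A * A = 1) : q G ≤ 2 := by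
  refine ((q_isLeast G).2 ⟨A, hA, rfl⟩).trans ?_
  have hsub : {μ : ℝ | Module.End.HasEigenvalue A.mulVecLin μ} ⊆ {1, -1} := by
    intro μ hμ
    obtain ⟨v, hv⟩ := hμ.exists_hasEigenvector
    have h1 : A *ᵥ v = μ • v := hv.apply_eq_smul
    have h2 : (μ * μ) • v = (1 : ℝ) • v := by
      rw [mul_smul, ← h1, ← mulVec_smul, ← h1, mulVec_mulVec, hsq, one_mulVec, one_smul]
    exact mul_self_eq_one_iff.1 (smul_left_injective ℝ hv.2 h2)
  exact (Set.ncard_le_ncard hsub (Set.toFinite _)).trans ((Set.ncard_insert_le _ _).trans (by simp))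

/-- Finitely many polynomial functions, none identically zero, have a common nonzero. -/
theorem exists_forall_eval_ne_zero {σ κ : Type*} [Finite κ] (p : κ → MvPolynomial σ ℝ)
    (h : ∀ k, ∃ u, MvPolynomial.eval u (p k) ≠ 0) : ∃ u, ∀ k, MvPolynomial.eval u (p k) ≠ 0 := by
  have := Fintype.ofFinite κ
  have hp : ∏ k, p k ≠ 0 := Finset.prod_ne_zero_iff.2 fun k _ hk => by
    obtain ⟨u, hu⟩ := h k
    simp [hk] at hu
  by_contra! hcon
  refine hp (MvPolynomial.funext fun u => ?_)
  obtain ⟨k, hk⟩ := hcon u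
  rw [map_prod, map_zero]
  exact Finset.prod_eq_zero (Finset.mem_univ k) hk

/-! ### Generic Householder reflections -/

section Householder

variable {V W : Type*} [Fintype V] [DecidableEq V]

/-- The Householder reflection along `u`. -/
noncomputable def householder (u : V → ℝ) : Matrix V V ℝ :=
  1 - (2 / (u ⬝ᵥ u)) • vecMulVec u u

theorem householder_transpose (u : V → ℝ) : (householder u)ᵀ = householder u := by
  simp [householder, transpose_vecMulVec]

theorem householder_mul_self {u : V → ℝ} (hu : u ⬝ᵥ u ≠ 0) :
    householder u * householder u = 1 := by
  simp only [householder, sub_mul, mul_sub, one_mul, mul_one, smul_mul_assoc, mul_smul_comm,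
    vecMulVec_mul_vecMulVec, vecMulVec_smul, smul_smul]
  ext i j
  simp [vecMulVec_apply]
  field_simp
  ring

/-- Clearing the denominator `u ⬝ᵥ u` leaves a polynomial in `u`. -/
theorem householder_mul_apply {u : V → ℝ} (hu : u ⬝ᵥ u ≠ 0) (R : Matrix V W ℝ) (i : V) (w : W) :
    (u ⬝ᵥ u) * (householder u * R) i w = (u ⬝ᵥ u) * R i w - 2 * u i * (u ⬝ᵥ R.col w) := by
  rw [householder, Matrix.sub_mul, Matrix.one_mul, Matrix.smul_mul, vecMulVec_mul]
  simp [vecMulVec_apply, vecMul]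
  field_simp
  rfl

theorem householder_conj_apply {u : V → ℝ} (hu : u ⬝ᵥ u ≠ 0) (N : Matrix V V ℝ) (hN : N.IsSymm)
    (i j : V) :
    (u ⬝ᵥ u) ^ 2 * (householder u * N * householder u) i j =
      N i j * (u ⬝ᵥ u) ^ 2 - 2 * u i * (u ⬝ᵥ u) * (u ⬝ᵥ N.col j)
        - 2 * u j * (u ⬝ᵥ u) * (u ⬝ᵥ N.col i) + 4 * u i * u j * (u ⬝ᵥ N *ᵥ u) := by
  have h1 : (N *ᵥ u) i = u ⬝ᵥ N.col i := by
    rw [mulVec, dotProduct_comm]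
    congr 1
    funext k
    exact hN.apply _ _
  simp only [householder, sub_mul, mul_sub, one_mul, mul_one, smul_mul_assoc, mul_smul_comm,
    vecMulVec_mul, mul_vecMulVec, vecMulVec_mulVec]
  simp [vecMulVec_apply, h1, vecMul, dotProduct_mulVec]
  change _ = _ - _ * (u ⬝ᵥ fun k => N k j) - _ + _
  field_simp
  ring

theorem exists_householder_mul_apply_ne_zero (R : Matrix V W ℝ) (w : W) (hw : R.col w ≠ 0) (i : V) :
    ∃ u : V → ℝ, (u ⬝ᵥ u) * R i w - 2 * u i * (u ⬝ᵥ R.col w) ≠ 0 := by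
  by_contra! h
  have hi : R i w = 0 := by
    have := h (Pi.single i 1)
    simp at this
    linarith
  refine hw (funext fun j => ?_)
  by_cases hij : j = i
  · rw [hij]; exact hi
  have := h (Pi.single i 1 + Pi.single j 1)
  simp [hi, Ne.symm hij] at this
  exact this

/-- If the polynomial vanished identically, evaluating it at combinations of at most four basis
vectors would force `N` to be scalar. -/
theorem exists_householder_conj_apply_ne_zero (N : Matrix V V ℝ) (hN : N.IsSymm)
    (hs : ∀ c : ℝ, N ≠ c • 1) {i j : V} (hij : i ≠ j) :
    ∃ u : V → ℝ, N i j * (u ⬝ᵥ u) ^ 2 - 2 * u i * (u ⬝ᵥ u) * (u ⬝ᵥ N.col j)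
        - 2 * u j * (u ⬝ᵥ u) * (u ⬝ᵥ N.col i) + 4 * u i * u j * (u ⬝ᵥ N *ᵥ u) ≠ 0 := by
  by_contra! h
  have hji := hij.symm
  have sym : ∀ a b, N a b = N b a := fun a b => hN.apply b a
  have h0 : N i j = 0 := by
    have := h (Pi.single j 1)
    simp [hij, sym j i] at this
    linarith
  have h0' : N j i = 0 := by rw [sym, h0]
  have hki : ∀ k, k ≠ i → N k i = 0 := by
    intro k hk
    by_cases hkj : k = j
    · rw [hkj, h0']
    have := h (Pi.single j 1 + Pi.single k 1)
    simp [hij, h0, h0', hk.symm, hkj, Ne.symm hkj] at this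
    tauto
  have hkj : ∀ k, k ≠ j → N k j = 0 := by
    intro k hk
    by_cases hki : k = i
    · rw [hki, h0]
    have := h (Pi.single i 1 + Pi.single k 1)
    simp [hji, h0, hk.symm, hki, Ne.symm hki] at this
    tauto
  have hjj : N j j = N i i := by
    -- Unequal weights are needed: at `e_i + e_j` the diagonal terms cancel.
    have := h ((2 : ℝ) • Pi.single i 1 + Pi.single j 1)
    simp [hij, hji, h0, h0', mulVec_add, mulVec_smul] at this
    linarith
  have hkk : ∀ k, N k k = N i i := by
    intro k
    by_cases hk1 : k = i
    · rw [hk1]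
    by_cases hk2 : k = j
    · rw [hk2, hjj]
    have := h (Pi.single i 1 + Pi.single j 1 + Pi.single k 1)
    simp [hij, hji, h0, h0', mulVec_add, hk1, hk2, Ne.symm hk1, Ne.symm hk2, hki, hkj, sym i k,
      sym j k, hjj] at this
    linarith
  have hkl : ∀ k l, k ≠ l → N k l = 0 := by
    intro k l hne
    by_cases hk1 : k = i
    · rw [hk1, sym]; exact hki l fun e => hne (hk1.trans e.symm)
    by_cases hk2 : k = j
    · rw [hk2, sym]; exact hkj l fun e => hne (hk2.trans e.symm)
    by_cases hl1 : l = i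
    · rw [hl1]; exact hki k hk1
    by_cases hl2 : l = j
    · rw [hl2]; exact hkj k hk2
    have := h (Pi.single i 1 + Pi.single j 1 + Pi.single k 1 + Pi.single l 1)
    simp [hij, hji, h0, h0', mulVec_add, hk1, hk2, Ne.symm hk1, Ne.symm hk2, hki, hkj, sym i k,
      sym j k, hjj, hl1, hl2, Ne.symm hl1, Ne.symm hl2, sym i l, sym j l, hkk, hne, hne.symm,
      sym l k] at this
    linarith
  refine hs (N i i) ?_
  ext a b
  by_cases hab : a = b
  · subst hab; simp [hkk a]
  · simp [hab, hkl a b hab]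

/-- A suitable Householder reflection makes all entries of `R` and all off-diagonal entries
of the conjugate of `N` nonzero. -/
theorem exists_householder [Finite W] (R : Matrix V W ℝ) (hR : ∀ w, R.col w ≠ 0)
    (N : Matrix V V ℝ) (hN : N.IsSymm) (hs : Nontrivial V → ∀ c : ℝ, N ≠ c • 1) :
    ∃ Q : Matrix V V ℝ, Qᵀ = Q ∧ Q * Q = 1 ∧ (∀ i w, (Q * R) i w ≠ 0) ∧
      ∀ i j, i ≠ j → (Q * N * Q) i j ≠ 0 := by
  let X : V → MvPolynomial V ℝ := MvPolynomial.X
  let g : MvPolynomial V ℝ := X ⬝ᵥ X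
  let lin : (V → ℝ) → MvPolynomial V ℝ := fun r => X ⬝ᵥ fun k => MvPolynomial.C (r k)
  have hX : ∀ u k, MvPolynomial.eval u (X k) = u k := fun u k => MvPolynomial.eval_X k
  have hg : ∀ u, MvPolynomial.eval u g = u ⬝ᵥ u := fun u => by simp [g, dotProduct, hX]
  have hlin : ∀ u r, MvPolynomial.eval u (lin r) = u ⬝ᵥ r := fun u r => by
    simp [lin, dotProduct, hX]
  let a : V × W → MvPolynomial V ℝ := fun x =>
    g * MvPolynomial.C (R x.1 x.2) - 2 * X x.1 * lin (R.col x.2)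
  have ha : ∀ u x, MvPolynomial.eval u (a x) =
      (u ⬝ᵥ u) * R x.1 x.2 - 2 * u x.1 * (u ⬝ᵥ R.col x.2) := fun u x => by
    simp [a, hg, hlin, hX]
  let b : {x : V × V // x.1 ≠ x.2} → MvPolynomial V ℝ := fun x =>
    MvPolynomial.C (N x.1.1 x.1.2) * g ^ 2 - 2 * X x.1.1 * g * lin (N.col x.1.2)
      - 2 * X x.1.2 * g * lin (N.col x.1.1) + 4 * X x.1.1 * X x.1.2 * (X ⬝ᵥ fun k => lin (N k))
  have hb : ∀ u x, MvPolynomial.eval u (b x) =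
      N x.1.1 x.1.2 * (u ⬝ᵥ u) ^ 2 - 2 * u x.1.1 * (u ⬝ᵥ u) * (u ⬝ᵥ N.col x.1.2)
        - 2 * u x.1.2 * (u ⬝ᵥ u) * (u ⬝ᵥ N.col x.1.1)
        + 4 * u x.1.1 * u x.1.2 * (u ⬝ᵥ N *ᵥ u) := fun u x => by
    have : MvPolynomial.eval u (X ⬝ᵥ fun k => lin (N k)) = u ⬝ᵥ N *ᵥ u := by
      rw [dotProduct, map_sum, dotProduct]
      refine Finset.sum_congr rfl fun k _ => ?_
      rw [map_mul, hX, hlin, mulVec, dotProduct_comm u]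
    simp [b, hg, hlin, hX, this]
  obtain hV | hV := isEmpty_or_nonempty V
  · exact ⟨1, by simp, by simp, fun i => hV.elim i, fun i => hV.elim i⟩
  -- The index `none` carries the extra condition `u ⬝ᵥ u ≠ 0`.
  obtain ⟨u, hu⟩ := exists_forall_eval_ne_zero
    (fun o : Option ((V × W) ⊕ {x : V × V // x.1 ≠ x.2}) => o.elim g (Sum.elim a b)) (by
      rintro (_ | ⟨i, w⟩ | ⟨⟨i, j⟩, hij⟩)
      · exact ⟨1, by simp [hg]⟩
      · simp only [Option.elim, Sum.elim_inl, ha]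
        exact exists_householder_mul_apply_ne_zero R w (hR w) i
      · simp only [Option.elim, Sum.elim_inr, hb]
        exact exists_householder_conj_apply_ne_zero N hN (hs ⟨i, j, hij⟩) hij)
  have hu0 : u ⬝ᵥ u ≠ 0 := hg u ▸ hu none
  refine ⟨householder u, householder_transpose u, householder_mul_self hu0, ?_, ?_⟩
  · intro i w h
    have := hu (some (Sum.inl (i, w)))
    simp only [Option.elim, Sum.elim_inl, ha] at this
    rw [← householder_mul_apply hu0, h, mul_zero] at this
    exact this rfl
  · intro i j hij h
    have := hu (some (Sum.inr ⟨(i, j), hij⟩))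
    simp only [Option.elim, Sum.elim_inr, hb] at this
    rw [← householder_conj_apply hu0 N hN, h, mul_zero] at this
    exact this rfl

end Householder

/-! ### The contraction and its Gram factor -/

/-- Every graph has a matrix in `𝒮(H)` with `1 - S²` positive definite that is not scalar
unless there is only one vertex. -/
theorem exists_contraction_mem_matricesOf {W : Type*} [Fintype W] [DecidableEq W] [Nonempty W]
    (H : SimpleGraph W) : ∃ S ∈ matricesOf H, (1 - S * S).PosDef ∧
      (Nontrivial W → ∀ c : ℝ, S ≠ c • 1) := by
  classical
  obtain ⟨w₀⟩ := ‹Nonempty W›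
  -- The single diagonal `1` makes `T` nonscalar once there is a second vertex. Below, `C` is the
  -- squared Frobenius norm, so scaling by `1 / √(C + 1)` gives a strict contraction.
  let T : Matrix W W ℝ := diagonal (Pi.single w₀ 1) + H.adjMatrix ℝ
  have hT : T.IsSymm := (isSymm_diagonal _).add H.isSymm_adjMatrix
  let C := ∑ i, ∑ j, T i j ^ 2
  have hC : 0 ≤ C := by positivity
  have hbound : ∀ x : W → ℝ, (T *ᵥ x) ⬝ᵥ (T *ᵥ x) ≤ C * (x ⬝ᵥ x) := by
    intro x
    simp only [dotProduct, C, Finset.sum_mul, ← pow_two]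
    refine Finset.sum_le_sum fun i _ => ?_
    rw [← Finset.sum_mul]
    exact Finset.sum_mul_sq_le_sq_mul_sq _ _ _
  let e : ℝ := (Real.sqrt (C + 1))⁻¹
  have he : 0 < e := by positivity
  have he2 : e * e = (C + 1)⁻¹ := by
    rw [← mul_inv, Real.mul_self_sqrt (by positivity)]
  have hS : (e • T).IsSymm := hT.smul e
  refine ⟨e • T, ⟨hS, fun i j hij => ?_⟩, ?_, ?_⟩
  · simp [T, he.ne', hij, SimpleGraph.adjMatrix_apply]
  · refine PosDef.of_dotProduct_mulVec_pos ?_ fun x hx => ?_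
    · rw [IsHermitian, conjTranspose_eq_transpose_of_trivial, transpose_sub, transpose_one,
        transpose_mul, hS.eq]
    · have hx2 : 0 < x ⬝ᵥ x := by
        rw [← star_trivial x]; simpa using dotProduct_star_self_pos_iff.2 hx
      have key : star x ⬝ᵥ ((1 - e • T * e • T) *ᵥ x) =
          x ⬝ᵥ x - (e * e) * ((T *ᵥ x) ⬝ᵥ (T *ᵥ x)) := by
        rw [star_trivial, sub_mulVec, one_mulVec, dotProduct_sub, smul_mul_smul_comm, smul_mulVec,
          dotProduct_smul, smul_eq_mul, ← mulVec_mulVec, dotProduct_mulVec, ← mulVec_transpose,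
          hT.eq]
      rw [key, he2, sub_pos, inv_mul_lt_iff₀ (by positivity)]
      nlinarith [hbound x]
  · intro hW c hc
    obtain ⟨w, hw⟩ := exists_ne w₀
    have h1 := congrFun (congrFun hc w₀) w₀
    have h2 := congrFun (congrFun hc w) w
    simp [T, hw] at h1 h2
    rw [← h2] at h1
    exact he.ne' h1

/-- A positive definite matrix is a Gram matrix of vectors in any large enough space. -/
theorem exists_transpose_mul_self_eq {V W : Type*} [Fintype V] [Fintype W] [DecidableEq W]
    (hcard : Fintype.card W ≤ Fintype.card V) {P : Matrix W W ℝ} (hP : P.PosDef) :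
    ∃ R : Matrix V W ℝ, Rᵀ * R = P := by
  classical
  obtain ⟨f⟩ := Function.Embedding.nonempty_of_card_le hcard
  obtain ⟨B, hB⟩ : ∃ B : Matrix W W ℝ, P = star B * B := by
    open MatrixOrder in exact CStarAlgebra.nonneg_iff_eq_star_mul_self.1 hP.posSemidef.nonneg
  let E : Matrix V W ℝ := Matrix.of fun v w => if f w = v then 1 else 0
  have hE : Eᵀ * E = 1 := by
    ext a b
    simp [E, mul_apply, one_apply, eq_comm]
  refine ⟨E * B, ?_⟩
  rw [transpose_mul, Matrix.mul_assoc, ← Matrix.mul_assoc _ E, hE, Matrix.one_mul, hB,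
    star_eq_conjTranspose, conjTranspose_eq_transpose_of_trivial]

/-! ### Completion to an involution -/

section Involution

variable {V W : Type*} [DecidableEq V] [Fintype W] [DecidableEq W]

/-- The block completing `R` and `S` to an involution. -/
noncomputable def complementBlock (R : Matrix V W ℝ) (S : Matrix W W ℝ) : Matrix V V ℝ :=
  R * (1 + S)⁻¹ * Rᵀ - 1

theorem complementBlock_isSymm (R : Matrix V W ℝ) {S : Matrix W W ℝ} (hS : S.IsSymm) :
    (complementBlock R S).IsSymm := by
  simp [complementBlock, IsSymm, transpose_nonsing_inv, hS.eq, Matrix.mul_assoc]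

variable [Fintype V]

theorem complementBlock_conj (R : Matrix V W ℝ) (S : Matrix W W ℝ) {Q : Matrix V V ℝ}
    (hQ : Qᵀ = Q) (hQQ : Q * Q = 1) :
    complementBlock (Q * R) S = Q * complementBlock R S * Q := by
  simp [complementBlock, Matrix.mul_sub, Matrix.sub_mul, Matrix.mul_assoc, hQ, hQQ]

theorem isUnit_one_add {S : Matrix W W ℝ} (hP : (1 - S * S).PosDef) : IsUnit (1 + S) := by
  have h : (1 + S) * (1 - S) = 1 - S * S := by noncomm_ring
  exact isUnit_of_mul_isUnit_left (h ▸ hP.isUnit)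

/-- Since `Rᵀ * R = (1 + S) * (1 - S)`, the inverse cancels and `R * (1 - S) - R` remains. -/
theorem complementBlock_mul {R : Matrix V W ℝ} {S : Matrix W W ℝ} (hP : (1 - S * S).PosDef)
    (hR : Rᵀ * R = 1 - S * S) : complementBlock R S * R = -(R * S) := by
  have h : (1 + S) * (1 - S) = 1 - S * S := by noncomm_ring
  rw [complementBlock, Matrix.sub_mul, Matrix.one_mul, Matrix.mul_assoc, hR, ← h, Matrix.mul_assoc,
    nonsing_inv_mul_cancel_left _ _ ((isUnit_iff_isUnit_det _).1 (isUnit_one_add hP)),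
    Matrix.mul_sub, Matrix.mul_one]
  abel

theorem complementBlock_mul_self {R : Matrix V W ℝ} {S : Matrix W W ℝ} (hP : (1 - S * S).PosDef)
    (hR : Rᵀ * R = 1 - S * S) :
    complementBlock R S * complementBlock R S + R * Rᵀ = 1 := by
  have hd := (isUnit_iff_isUnit_det _).1 (isUnit_one_add hP)
  have hcomm : S * (1 + S)⁻¹ = 1 - (1 + S)⁻¹ := by
    rw [eq_sub_iff_add_eq']
    simpa [add_mul] using mul_nonsing_inv _ hd
  conv_lhs => enter [1, 2]; rw [complementBlock]
  rw [Matrix.mul_sub, Matrix.mul_one, ← Matrix.mul_assoc, ← Matrix.mul_assoc,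
    complementBlock_mul hP hR, Matrix.neg_mul, Matrix.mul_assoc R S, hcomm, complementBlock,
    Matrix.mul_sub, Matrix.mul_one, Matrix.neg_mul, Matrix.sub_mul]
  abel

/-- If the block were `c • 1`, then `c • R = -(R * S)`; multiplying by `Rᵀ` and cancelling the
invertible `1 - S * S` gives `S = (-c) • 1`. -/
theorem complementBlock_ne_smul_one {R : Matrix V W ℝ} {S : Matrix W W ℝ}
    (hP : (1 - S * S).PosDef) (hR : Rᵀ * R = 1 - S * S) [Nonempty W] [Nontrivial V]
    (hS : Nontrivial W → ∀ c : ℝ, S ≠ c • 1) (c : ℝ) : complementBlock R S ≠ c • 1 := by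
  intro hc
  have h1 : c • R = -(R * S) := by
    rw [← complementBlock_mul hP hR, hc, smul_mul, Matrix.one_mul]
  have h2 : (1 - S * S) * (c • 1) = (1 - S * S) * (-S) := by
    rw [Matrix.mul_smul, Matrix.mul_one, ← hR, ← Matrix.mul_smul, Matrix.mul_assoc, Matrix.mul_neg,
      ← h1]
  have h3 : S = (-c) • 1 := by
    rw [neg_smul, ← neg_eq_iff_eq_neg]
    exact (hP.isUnit.mul_left_cancel h2).symm
  -- For a single `w`, `R` is one column and `c² • 1 + R * Rᵀ = 1`. Two distinct entries of `R` have
  -- product zero, so one vanishes and `c² = 1`, against `1 - c² > 0`.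
  obtain hW | hW := subsingleton_or_nontrivial W
  · obtain ⟨w⟩ := ‹Nonempty W›
    have : Unique W := uniqueOfSubsingleton w
    obtain ⟨i, j, hij⟩ := exists_pair_ne V
    have h4 := complementBlock_mul_self hP hR
    rw [hc] at h4
    have e1 := congrFun (congrFun h4 i) j
    have e2 := congrFun (congrFun h4 i) i
    have e3 := congrFun (congrFun h4 j) j
    have e4 : 0 < (1 - S * S) w w := hP.diag_pos
    rw [h3] at e4
    simp [mul_apply, hij] at e1 e2 e3 e4
    rcases e1 with e | e
    · rw [e] at e2; linarith
    · rw [e] at e3; linarith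
  · exact hS hW _ h3

end Involution

theorem q_join_completeGraph_le_two {V W : Type*} [Fintype V] [Fintype W] [Nonempty W]
    (H : SimpleGraph W) (hcard : Fintype.card W ≤ Fintype.card V) :
    q (join (SimpleGraph.completeGraph V) H) ≤ 2 := by
  classical
  obtain ⟨S, ⟨hS, hpat⟩, hP, hns⟩ := exists_contraction_mem_matricesOf H
  obtain ⟨R₀, hR₀⟩ := exists_transpose_mul_self_eq (V := V) hcard hP
  have hcol : ∀ w, R₀.col w ≠ 0 := by
    intro w h
    have h1 : 0 < (1 - S * S) w w := hP.diag_pos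
    rw [← hR₀, mul_apply] at h1
    refine h1.ne' (Finset.sum_eq_zero fun v _ => ?_)
    have : R₀ v w = 0 := congrFun h v
    rw [this, mul_zero]
  -- `Q` acts on the `V` side only, so the pattern of `S` on `H` is untouched.
  obtain ⟨Q, hQ, hQQ, hQR, hQN⟩ := exists_householder R₀ hcol (complementBlock R₀ S)
    (complementBlock_isSymm R₀ hS) fun _ => complementBlock_ne_smul_one hP hR₀ hns
  rw [← complementBlock_conj R₀ S hQ hQQ] at hQN
  have hR : (Q * R₀)ᵀ * (Q * R₀) = 1 - S * S := by
    rw [transpose_mul, hQ, Matrix.mul_assoc, ← Matrix.mul_assoc Q, hQQ, Matrix.one_mul, hR₀]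
  generalize Q * R₀ = R at hQR hQN hR
  have hNR := complementBlock_mul hP hR
  have hRN : Rᵀ * complementBlock R S = -(S * Rᵀ) := by
    have := congrArg transpose hNR
    rwa [transpose_mul, transpose_neg, transpose_mul, hS.eq,
      (complementBlock_isSymm R hS).eq] at this
  refine q_le_two_of_mul_self (A := fromBlocks (complementBlock R S) R Rᵀ S) ⟨?_, ?_⟩ ?_
  · exact IsSymm.fromBlocks (complementBlock_isSymm R hS) rfl hS
  · rintro (i | i) (j | j) hij
    · have hij' : i ≠ j := fun h => hij (congrArg _ h)
      simp [join, hQN i j hij', hij']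
    · simp [join, hQR]
    · simp [join, hQR]
    · simpa [join] using hpat i j fun h => hij (congrArg _ h)
  · rw [fromBlocks_multiply, hNR, hRN, hR, complementBlock_mul_self hP hR]
    simp

end QParam

theorem mainTheorem6 {V W : Type*} [Fintype V] [Fintype W] [Nonempty W]
    (H : SimpleGraph W) (hcard : Fintype.card W ≤ Fintype.card V) :
    QParam.q (QParam.join (SimpleGraph.completeGraph V) H) = 2 := by
  refine le_antisymm (QParam.q_join_completeGraph_le_two H hcard) ?_
  obtain ⟨w⟩ := ‹Nonempty W›
  obtain ⟨v⟩ : Nonempty V :=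
    Fintype.card_pos_iff.1 ((Fintype.card_pos_iff.2 ⟨w⟩).trans_le hcard)
  exact QParam.two_le_q_of_adj (i := Sum.inl v) (j := Sum.inr w) (by simp [QParam.join])
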